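/- **Mesh.** Let $\mathcal T$ be a finite, purely topological mesh of quadrilaterals, with vertices $\mathcal T_0$, edges $\mathcal T_1$, faces $\mathcal T_2$ (every vertex and edge lies in a face; each face has four distinct vertices; no hanging nodes). Every edge lies in at most two faces, and there are no kissing vertices: any two faces containing a vertex $\gamma$ are joined by a chain of faces containing $\gamma$ in which consecutive faces share an interior edge containing $\gamma$. The valence $\mu$ of a vertex or edge is the number of faces containing it. Boundary edges ($\mathcal T_1^B$) are those of valence $1$, the other edges are interior; boundary vertices are those on a boundary edge, the other vertices are interior. Corners ($\mathcal T_0^C$) are the vertices of valence $1$. Extraordinary vertices ($\mathcal T_0^E$) are the interior vertices of valence $\ne4$ and the boundary vertices of valence $>2$. A face with an extraordinary vertex is called extraordinary. **Functions $B^*_\phi$.** Identify each face with $[0,1]^2$; a function on $\mathcal T$ is given by its restriction to each face. For $\phi\in\mathcal I^*=\mathcal T_2\cup\mathcal T_1^B\cup\mathcal T_0^C$ let $B^*_\phi$ be the function that is biquadratic on each face, with Bernstein–Bézier coefficients $c_{jk}[B^*_\phi;\sigma]$, $0\le j,k\le2$, attached to the vertices, edges and centre of $\sigma$ as follows (and shared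 between faces with a common vertex or edge). If $\phi$ is a face: $1$ at its centre, $1/2$ at its interior edges, $1/\mu_\gamma$ at its interior vertices $\gamma$. If $\phi$ is a boundary edge: $1$ at this edge, $1/2$ at each of its vertices that is not a corner. If $\phi$ is a corner: $1$ at this vertex. All other coefficients are $0$. **Truncation.** Let $K\in\mathbb R^{4\times3}$ be the knot insertion matrix with rows $(1,0,0),(\tfrac12,\tfrac12,0),(0,\tfrac12,\tfrac12),(0,0,1)$. Split the index set $\{0,1,2,3\}^2$ of $4\times4$ coefficient arrays on a face into four $2\times2$ blocks, one at each vertex of the face. Let $b^1_{jk}$, $0\le j,k\le 3$, be the tensor-product quadratic B-splines with knots $(0,0,0,\frac12,1,1,1)$ in both directions. For $\phi\in\mathcal I^*$ let $B_\phi=B_\phi^*$ on non-extraordinary faces, and on an extraordinary face $\sigma$ let $B_\phi|_\sigma=\sum_{j,k}\hat c_{jk}b^1_{jk}$, where $\hat c$ is $K\,c[B^*_\phi;\sigma]\,K^T$ with the blocks at extraordinary vertices of $\sigma$ set to $0$. **Extraordinary vertex functions.** Let control points $\mathbf x^*_\phi\in\mathbb R^d$ ($\phi\in\mathcal I^*$,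 $d\ge2$) be given, put $\mathbf x^*=\sum_\phi\mathbf x^*_\phi B^*_\phi$, and for each $\gamma\in\mathcal T_0^E$ prescribe $d-2$ linearly independent normals (one $\mathbf n_\gamma\neq0$ if $d=3$, none if $d=2$). Let $P_\gamma$ be the orthogonal projection onto the tangent plane, i.e. the plane through $\mathbf x^*(\gamma)$ orthogonal to these normals. The local control points at $\gamma$ are the images under $P_\gamma$ of the coefficients of $K\,c[\mathbf x^*;\sigma]\,K^T$ in the block at $\gamma$, over all faces $\sigma\ni\gamma$. Assume that, for each $\gamma\in\mathcal T_0^E$, they are not all collinear (this holds if the projected surface $P_\gamma(\mathbf x^*)$ is regular at $\gamma$). Choose any nondegenerate triangle in the tangent plane that contains all of them, with vertices $\mathbf x_{(\gamma,1)},\mathbf x_{(\gamma,2)},\mathbf x_{(\gamma,3)}$ and barycentric coordinates $\lambda_1,\lambda_2,\lambda_3$. Then $B_{(\gamma,\nu)}|_\sigma=\sum_{j,k}\hat c_{jk}b^1_{jk}$, where $\hat c_{jk}$ is the value of $\lambda_\nu$ at the corresponding local control point if $(j,k)$ is in the block at $\gamma$, and $0$ otherwise; $B_{(\gamma,\nu)}|_\sigma=0$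 if $\gamma\notin\sigma$. **Index set and space.** Let $\mathcal I$ consist of the faces and the boundary edges that have at least one vertex that is not extraordinary, the corners $\mathcal T_0^C$, and $\mathcal T_0^E\times\{1,2,3\}$. Put $\mathcal B=\operatorname{span}(B_\phi:\phi\in\mathcal I)$. **Proposition 3.8.** (a) $|\mathcal I|\le|\mathcal T_2|+|\mathcal T_1^B|+|\mathcal T_0^C|+3|\mathcal T_0^E|$, with equality if no face and no boundary edge has only extraordinary vertices. (b) $B_\phi|_\sigma\ge0$ for all $\phi\in\mathcal I$, $\sigma\in\mathcal T_2$. (c) $\sum_{\phi\in\mathcal I}B_\phi|_\sigma\equiv1$ for all $\sigma\in\mathcal T_2$. (d) If $\phi\in\mathcal I$ is a face, boundary edge or corner and $\sigma\cap\phi=\emptyset$, then $B_\phi|_\sigma=0$; and $B_{(\gamma,\nu)}|_\sigma=0$ whenever $\gamma\in\mathcal T_0^E$ and $\gamma\notin\sigma$. (e) For each face $\phi\in\mathcal I$, $B_\phi$ vanishes on the boundary of $\mathcal T$, i.e. on every boundary edge and at every boundary vertex of every face. (f) $\{B_\phi:\phi\in\mathcal I\}$ is linearly independent and is a basis of $\mathcal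 B$. -/

import Mathlib

namespace AlmostC1

/-- Finite quadrilateral cell structure with vertices `V`, edges `E` and faces `F`, purely
topological.  The vertices of a face are listed cyclically, `vert σ 0, …, vert σ 3`; they are placed
at the points `(0,0), (1,0), (1,1), (0,1)` of the local coordinate square `[0,1]²`, and `edge σ i`
is the edge joining `vert σ i` to `vert σ (i+1)`.  Distinct faces may be labelled with unrelated
starting points and orientations. -/
structure QuadComplex (V E F : Type*) where
  vert : F → Fin 4 → V
  edge : F → Fin 4 → E
  ends : E → Sym2 V
  vert_injective : ∀ σ, Function.Injective (vert σ)
  ends_edge : ∀ σ i, ends (edge σ i) = s(vert σ i, vert σ (i + 1))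
  vert_cover : ∀ γ, ∃ σ i, vert σ i = γ
  edge_cover : ∀ τ, ∃ σ i, edge σ i = τ

namespace QuadComplex

variable {V E F : Type*} (M : QuadComplex V E F)

/-- The vertex `γ` lies in the face `σ`. -/
def VertInFace (γ : V) (σ : F) : Prop := ∃ i, M.vert σ i = γ

/-- The vertex `γ` lies in the edge `τ`. -/
def VertInEdge (γ : V) (τ : E) : Prop := γ ∈ M.ends τ

/-- The edge `τ` lies in the face `σ`. -/
def EdgeInFace (τ : E) (σ : F) : Prop := ∃ i, M.edge σ i = τ

/-- The valence of a vertex: the number of faces that contain it. -/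
noncomputable def vertValence (γ : V) : ℕ := {σ : F | M.VertInFace γ σ}.ncard

/-- The valence of an edge: the number of faces that contain it. -/
noncomputable def edgeValence (τ : E) : ℕ := {σ : F | M.EdgeInFace τ σ}.ncard

/-- Boundary edges are those contained in only one face; the others are interior edges. -/
def IsBoundaryEdge (τ : E) : Prop := M.edgeValence τ = 1

/-- Boundary vertices are those lying on a boundary edge; the others are interior vertices. -/
def IsBoundaryVertex (γ : V) : Prop := ∃ τ, M.IsBoundaryEdge τ ∧ M.VertInEdge γ τ

/-- Interior vertices of valence `≠ 4` and boundary vertices of valence `> 2`. -/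
def IsExtraordinary (γ : V) : Prop :=
  (¬ M.IsBoundaryVertex γ ∧ M.vertValence γ ≠ 4) ∨ (M.IsBoundaryVertex γ ∧ 2 < M.vertValence γ)

/-- Corner vertices are the vertices of valence one. -/
def IsCorner (γ : V) : Prop := M.vertValence γ = 1

/-- Faces containing at least one extraordinary vertex. -/
def IsExtraordinaryFace (σ : F) : Prop := ∃ γ, M.VertInFace γ σ ∧ M.IsExtraordinary γ

/-- `σ` and `σ'` share an interior edge that contains `γ`. -/
def AdjacentAt (γ : V) (σ σ' : F) : Prop :=
  ∃ τ, ¬ M.IsBoundaryEdge τ ∧ M.VertInEdge γ τ ∧ M.EdgeInFace τ σ ∧ M.EdgeInFace τ σ'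

end QuadComplex

/-- Unstructured quadrilateral mesh: every edge is shared by at most two faces and there are no
kissing vertices (any two faces containing a vertex `γ` are joined by a chain of faces containing
`γ` in which neighbours share an interior edge). -/
structure QuadMesh (V E F : Type*) extends QuadComplex V E F where
  edgeValence_le_two : ∀ τ, toQuadComplex.edgeValence τ ≤ 2
  no_kissing : ∀ γ σ σ', toQuadComplex.VertInFace γ σ → toQuadComplex.VertInFace γ σ' →
    Relation.ReflTransGen (toQuadComplex.AdjacentAt γ) σ σ'

/-- The matrix inserting the knot `1/2` into a quadratic Bézier element on `[0,1]`. -/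
noncomputable def knotInsertion : Matrix (Fin 4) (Fin 3) ℝ :=
  !![1, 0, 0; 1/2, 1/2, 0; 0, 1/2, 1/2; 0, 0, 1]

/-- The refined coefficients `K c Kᵀ`, for scalar or vector-valued coefficients `c`. -/
noncomputable def refine {A : Type*} [AddCommMonoid A] [Module ℝ A] (c : Fin 3 → Fin 3 → A)
    (j k : Fin 4) : A :=
  ∑ a, ∑ b, (knotInsertion j a * knotInsertion k b) • c a b

/-- The four `C¹` quadratic B-splines on `[0,1]` with knots `(0,0,0,1/2,1,1,1)`. -/
noncomputable def bspline (j : Fin 4) (t : ℝ) : ℝ :=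
  if t ≤ 1 / 2 then (![(1 - 2 * t) ^ 2, 2 * t * (2 - 3 * t), 2 * t ^ 2, 0] : Fin 4 → ℝ) j
  else (![0, 2 * (1 - t) ^ 2, 2 * (1 - t) * (3 * t - 1), (2 * t - 1) ^ 2] : Fin 4 → ℝ) j

/-- Local coordinates on a face. -/
abbrev UnitSquare : Type := unitInterval × unitInterval

/-- The biquadratic polynomial with Bernstein–Bézier coefficients `c`. -/
noncomputable def bezierFun (c : Fin 3 → Fin 3 → ℝ) (ξ : UnitSquare) : ℝ :=
  ∑ j : Fin 3, ∑ k : Fin 3, c j k * (bernstein 2 j ξ.1 * bernstein 2 k ξ.2)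

/-- The tensor-product `C¹` biquadratic spline with one inner knot per direction and
coefficients `c`. -/
noncomputable def splineFun (c : Fin 4 → Fin 4 → ℝ) (ξ : UnitSquare) : ℝ :=
  ∑ j : Fin 4, ∑ k : Fin 4, c j k * (bspline j ξ.1 * bspline k ξ.2)

/-- The local number of the face vertex whose `2 × 2` coefficient block contains `(j, k)`. -/
def nearestVertex (j k : Fin 4) : Fin 4 :=
  if j < 2 then (if k < 2 then 0 else 3) else (if k < 2 then 1 else 2)

/-- The local coordinates of points on the `i`-th edge of a face. -/
def OnLocalEdge (i : Fin 4) (ξ : UnitSquare) : Prop :=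
  (![ξ.2 = 0, ξ.1 = 1, ξ.2 = 1, ξ.1 = 0] : Fin 4 → Prop) i

/-- The local coordinates of the `i`-th vertex of a face. -/
def localVertex (i : Fin 4) : UnitSquare :=
  (![(0, 0), (1, 0), (1, 1), (0, 1)] : Fin 4 → UnitSquare) i

namespace QuadMesh

variable {V E F : Type*} (M : QuadMesh V E F)

/-- The degrees of freedom `𝓘* = 𝓣₂ ∪ 𝓣₁ᴮ ∪ 𝓣₀ᶜ`. -/
abbrev StarDof : Type _ := F ⊕ {τ : E // M.IsBoundaryEdge τ} ⊕ {γ : V // M.IsCorner γ}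

/-- The extraordinary vertices `𝓣₀ᴱ`. -/
abbrev ExtraVert : Type _ := {γ : V // M.IsExtraordinary γ}

/-- The degrees of freedom `𝓘` of the almost-`C¹` splines: faces and boundary edges with at least
one vertex that is not extraordinary, corner vertices, and three per extraordinary vertex. -/
abbrev Dof : Type _ :=
  {σ : F // ∃ γ, ¬ M.IsExtraordinary γ ∧ M.VertInFace γ σ} ⊕
  {τ : E // M.IsBoundaryEdge τ ∧ ∃ γ, ¬ M.IsExtraordinary γ ∧ M.VertInEdge γ τ} ⊕
  {γ : V // M.IsCorner γ} ⊕
  (M.ExtraVert × Fin 3)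

noncomputable instance [Fintype V] [Fintype E] [Fintype F] : Fintype M.StarDof :=
  Fintype.ofFinite _

noncomputable instance [Fintype V] [Fintype E] [Fintype F] : Fintype M.Dof :=
  Fintype.ofFinite _

open Classical in
/-- The Bernstein–Bézier coefficient of `B*_φ` at a domain point of the mesh.  The domain points
of a face are its four vertices, (the midpoints of) its four edges and (the centre of) the face
itself; domain points on common edges and vertices are shared by the incident faces.
* A face function has coefficient `1` at its own face, `1/2` at its interior edges, `1/μ_γ` at its
  interior vertices `γ`, and `0` elsewhere.
* The function of a boundary edge has coefficient `1` at this edge, `1/2` at those of its two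
  vertices that are not corners, and `0` elsewhere.
* The function of a corner has coefficient `1` at this vertex and `0` elsewhere. -/
noncomputable def starCoeff : M.StarDof → V ⊕ E ⊕ F → ℝ
  | .inl σ, .inl γ =>
      if M.VertInFace γ σ ∧ ¬ M.IsBoundaryVertex γ then 1 / (M.vertValence γ : ℝ) else 0
  | .inl σ, .inr (.inl τ) => if M.EdgeInFace τ σ ∧ ¬ M.IsBoundaryEdge τ then 1 / 2 else 0
  | .inl σ, .inr (.inr σ') => if σ' = σ then 1 else 0
  | .inr (.inl τ), .inl γ => if M.VertInEdge γ τ.1 ∧ ¬ M.IsCorner γ then 1 / 2 else 0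
  | .inr (.inl τ), .inr (.inl τ') => if τ' = τ.1 then 1 else 0
  | .inr (.inl _), .inr (.inr _) => 0
  | .inr (.inr γ), .inl γ' => if γ' = γ.1 then 1 else 0
  | .inr (.inr _), .inr _ => 0

/-- The domain point of the face `σ` with index `(j, k)`, at local coordinates `(j/2, k/2)`. -/
def domainPoint (σ : F) (j k : Fin 3) : V ⊕ E ⊕ F :=
  (!![.inl (M.vert σ 0), .inr (.inl (M.edge σ 3)), .inl (M.vert σ 3);
      .inr (.inl (M.edge σ 0)), .inr (.inr σ), .inr (.inl (M.edge σ 2));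
      .inl (M.vert σ 1), .inr (.inl (M.edge σ 1)), .inl (M.vert σ 2)] :
    Matrix (Fin 3) (Fin 3) (V ⊕ E ⊕ F)) j k

/-- The face-local coefficients `c_{jk}[B*_φ; σ]`. -/
noncomputable def localStarCoeff (φ : M.StarDof) (σ : F) (j k : Fin 3) : ℝ :=
  M.starCoeff φ (M.domainPoint σ j k)

open Classical in
/-- Entry `(j, k)` of the truncation matrix `T_i` of the face `σ`: if the `i`-th vertex is
extraordinary, the entries of the `2 × 2` block at this vertex are `0`; all others are `1`. -/
noncomputable def truncation (σ : F) (i j k : Fin 4) : ℝ :=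
  if M.IsExtraordinary (M.vert σ i) ∧ nearestVertex j k = i then 0 else 1

open Classical in
/-- The function obtained from `B*_φ`: unchanged on regular faces, subdivided and truncated on
extraordinary faces. -/
noncomputable def truncatedFun (φ : M.StarDof) (σ : F) (ξ : UnitSquare) : ℝ :=
  if M.IsExtraordinaryFace σ then
    splineFun (fun j k => refine (M.localStarCoeff φ σ) j k * ∏ i, M.truncation σ i j k) ξ
  else bezierFun (M.localStarCoeff φ σ) ξ

/-- The geometric data: control points `x*_φ ∈ ℝ^d`, `d = m + 2`, and at each extraordinary vertex
`m` linearly independent normal vectors.  For surfaces in `ℝ³` this is one normal `n_γ ≠ 0`; for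
planar geometries in `ℝ²` there is nothing to prescribe. -/
structure Geometry (m : ℕ) where
  ctrl : M.StarDof → EuclideanSpace ℝ (Fin (m + 2))
  normal : M.ExtraVert → Fin m → EuclideanSpace ℝ (Fin (m + 2))
  normal_indep : ∀ γ, LinearIndependent ℝ (normal γ)

namespace Geometry

variable {M} {m : ℕ} (G : M.Geometry m)

/-- The coefficient of `x* = ∑ x*_φ B*_φ` at a domain point; at a vertex this is the value of
`x*`. -/
noncomputable def pointCoeff [Fintype V] [Fintype E] [Fintype F] (D : V ⊕ E ⊕ F) :
    EuclideanSpace ℝ (Fin (m + 2)) :=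
  ∑ φ, M.starCoeff φ D • G.ctrl φ

/-- The refined coefficients `ĉ_{jk}[x*; σ]`. -/
noncomputable def refinedCoeff [Fintype V] [Fintype E] [Fintype F] (σ : F) (j k : Fin 4) :
    EuclideanSpace ℝ (Fin (m + 2)) :=
  refine (fun a b => G.pointCoeff (M.domainPoint σ a b)) j k

/-- The directions orthogonal to the prescribed normal. -/
noncomputable def tangentDirection (γ : M.ExtraVert) :
    Submodule ℝ (EuclideanSpace ℝ (Fin (m + 2))) :=
  (Submodule.span ℝ (Set.range (G.normal γ)))ᗮ

/-- The tangent plane at `γ`: through `x*(γ)`, orthogonal to the prescribed normal. -/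
noncomputable def tangentPlane [Fintype V] [Fintype E] [Fintype F] (γ : M.ExtraVert) :
    AffineSubspace ℝ (EuclideanSpace ℝ (Fin (m + 2))) :=
  AffineSubspace.mk' (G.pointCoeff (.inl γ.1)) (G.tangentDirection γ)

/-- The orthogonal projection `P_γ` onto the tangent plane at `γ`. -/
noncomputable def proj [Fintype V] [Fintype E] [Fintype F] (γ : M.ExtraVert)
    (y : EuclideanSpace ℝ (Fin (m + 2))) : EuclideanSpace ℝ (Fin (m + 2)) :=
  G.pointCoeff (.inl γ.1) + (G.tangentDirection γ).starProjection (y - G.pointCoeff (.inl γ.1))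

/-- The projected local control points around `γ`: for each face containing `γ`, the projections
of the four refined coefficients in the `2 × 2` block at `γ`. -/
def localPoints [Fintype V] [Fintype E] [Fintype F] (γ : M.ExtraVert) :
    Set (EuclideanSpace ℝ (Fin (m + 2))) :=
  {c | ∃ σ j k, M.vert σ (nearestVertex j k) = γ.1 ∧ c = G.proj γ (G.refinedCoeff σ j k)}

/-- At every extraordinary vertex the projected local control points are not collinear.  This is
implied by regularity of the projected surface at the vertex, which says that on each incident
face the two partial derivatives at the vertex, positive multiples of differences of local control
points, are linearly independent. -/
def IsRegular [Fintype V] [Fintype E] [Fintype F] : Prop :=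
  ∀ γ : M.ExtraVert, ¬ Collinear ℝ (G.localPoints γ)

/-- A choice of control triangles: for each extraordinary vertex a nondegenerate triangle in the
tangent plane that contains all projected local control points. -/
structure ControlTriangles [Fintype V] [Fintype E] [Fintype F] where
  tri : M.ExtraVert → Affine.Triangle ℝ (EuclideanSpace ℝ (Fin (m + 2)))
  mem_plane : ∀ γ ν, (tri γ).points ν ∈ G.tangentPlane γ
  covers : ∀ γ, G.localPoints γ ⊆ (tri γ).closedInterior

end Geometry

open Classical in
/-- The barycentric coordinates of `c` with respect to the triangle `t` (the zero vector if `c` is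
not in the plane of `t`). -/
noncomputable def barycentric {m : ℕ} (t : Affine.Triangle ℝ (EuclideanSpace ℝ (Fin (m + 2))))
    (c : EuclideanSpace ℝ (Fin (m + 2))) : Fin 3 → ℝ :=
  if h : ∃ w : Fin 3 → ℝ, ∑ ν, w ν = 1 ∧ c = ∑ ν, w ν • t.points ν then h.choose else 0

namespace Geometry.ControlTriangles

variable [Fintype V] [Fintype E] [Fintype F] {M} {m : ℕ} {G : M.Geometry m}
  (T : G.ControlTriangles)

open Classical in
/-- The extraordinary vertex function `B_(γ,ν)`: its coefficients in the `2 × 2` blocks at `γ` are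
the barycentric coordinates of the projected local control points, all others vanish. -/
noncomputable def vertexFun (γ : M.ExtraVert) (ν : Fin 3) (σ : F) (ξ : UnitSquare) : ℝ :=
  splineFun (fun j k => if M.vert σ (nearestVertex j k) = γ.1 then
    barycentric (T.tri γ) (G.proj γ (G.refinedCoeff σ j k)) ν else 0) ξ

/-- The almost-`C¹` basis functions `B_φ`, `φ ∈ 𝓘`; `T.basisFun φ σ` is `B_φ|_σ`. -/
noncomputable def basisFun : M.Dof → F → UnitSquare → ℝ
  | .inl σ => M.truncatedFun (.inl σ.1)
  | .inr (.inl τ) => M.truncatedFun (.inr (.inl ⟨τ.1, τ.2.1⟩))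
  | .inr (.inr (.inl γ)) => M.truncatedFun (.inr (.inr γ))
  | .inr (.inr (.inr (γ, ν))) => T.vertexFun γ ν

/-- The almost-`C¹` spline space `𝓑`. -/
noncomputable def splineSpace : Submodule ℝ (F → UnitSquare → ℝ) :=
  Submodule.span ℝ (Set.range T.basisFun)

end Geometry.ControlTriangles

end QuadMesh

end AlmostC1

/-! Everything is read off from coefficients. On a face, the tensor-product Bernstein polynomials
and B-splines are nonnegative, sum to one and are linearly independent, so sign, partition of unity
and independence become statements about coefficient arrays.

Partition of unity: at every domain point the coefficients of all `B*_φ` sum to one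
(`sum_starCoeff`). The only case that needs global topology is a boundary vertex that is not a
corner, where exactly two boundary edges must meet, each contributing `1/2`. With `S` faces, `I`
interior and `B` boundary edges at the vertex, counting incidences gives `2S = B + 2I`, while
connectedness of the star gives `S ≤ I + 1`. Thus `B` is even, positive and at most two
(`card_boundaryEdges_at`). Knot insertion preserves constants, and the blocks truncated at
extraordinary vertices are refilled by barycentric coordinates, which also sum to one.

Support: the refined block at a vertex depends only on four domain points, whose cells all contain
that vertex. A function `B*_φ` is therefore zero in every block at a vertex outside `φ`.
Consequently `truncatedFun_eq_zero` yields both local support and the vanishing of all functions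
discarded from `𝓘*`, whose vertices are all extraordinary.

Independence: in a vanishing combination all local coefficients vanish. Knot insertion is invertible
block by block, so the unrefined coefficients near a vertex that is not extraordinary vanish too.
The centre of a face, a boundary edge and a corner each carry only their own function, which
isolates its coefficient. At an extraordinary vertex, a linear form in the barycentric coordinates
vanishes at noncollinear points, hence is zero (`eq_zero_of_not_collinear`). -/

namespace AlmostC1

/-! ### Univariate quadratic B-splines and Bernstein polynomials -/

section Univariate

lemma bspline_nonneg (j : Fin 4) {t : ℝ} (h0 : 0 ≤ t) (h1 : t ≤ 1) : 0 ≤ bspline j t := by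
  unfold bspline
  split_ifs with h
  · fin_cases j
    · exact sq_nonneg _
    · exact mul_nonneg (by linarith) (by linarith)
    · exact mul_nonneg (by norm_num) (sq_nonneg _)
    · exact le_rfl
  · fin_cases j
    · exact le_rfl
    · exact mul_nonneg (by norm_num) (sq_nonneg _)
    · exact mul_nonneg (by linarith) (by linarith)
    · exact sq_nonneg _

lemma sum_bspline (t : ℝ) : ∑ j, bspline j t = 1 := by
  unfold bspline
  split_ifs <;> simp [Fin.sum_univ_succ] <;> ring

lemma bspline_zero (j : Fin 4) : bspline j 0 = if j = 0 then 1 else 0 := by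
  fin_cases j <;> simp [bspline]

lemma bspline_one (j : Fin 4) : bspline j 1 = if j = 3 then 1 else 0 := by
  fin_cases j <;> simp [bspline] <;> norm_num

lemma bspline_coeff_eq_zero {c : Fin 4 → ℝ}
    (h : ∀ t : unitInterval, ∑ j, c j * bspline j t = 0) : c = 0 := by
  have h0 := h 0
  have h1 := h 1
  have h2 := h ⟨1 / 2, by norm_num, by norm_num⟩
  -- The end points isolate `c 0` and `c 3`. The two middle B-splines have equal values at `1/2` but
  -- values `5/8` and `1/8` at `1/4`, so these two points separate `c 1` and `c 2`.
  have h3 := h ⟨1 / 4, by norm_num, by norm_num⟩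
  simp only [Fin.sum_univ_four, Set.Icc.coe_zero, Set.Icc.coe_one, bspline_zero,
    bspline_one] at h0 h1
  have e : (1 / 4 : ℝ) ≤ 1 / 2 := by norm_num
  simp [Fin.sum_univ_four, bspline] at h0 h1 h2
  simp only [Fin.sum_univ_four, bspline, if_pos e, Matrix.cons_val] at h3
  norm_num at h2 h3
  funext j
  fin_cases j <;> simp <;> linarith

lemma sum_bernstein_two (t : unitInterval) : ∑ j : Fin 3, bernstein 2 j t = 1 := by
  simp [Fin.sum_univ_three, bernstein_apply]
  ring

lemma bernstein_two_coeff_eq_zero {c : Fin 3 → ℝ}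
    (h : ∀ t : unitInterval, ∑ j : Fin 3, c j * bernstein 2 j t = 0) : c = 0 := by
  have h0 := h 0
  have h1 := h 1
  have h2 := h ⟨1 / 2, by norm_num, by norm_num⟩
  simp [Fin.sum_univ_three, bernstein_apply] at h0 h1 h2
  norm_num at h2
  funext j
  fin_cases j <;> simp <;> linarith

end Univariate

/-! ### Tensor products and knot insertion -/

section Bivariate

lemma splineFun_nonneg {c : Fin 4 → Fin 4 → ℝ} (hc : ∀ j k, 0 ≤ c j k) (ξ : UnitSquare) :
    0 ≤ splineFun c ξ :=
  Finset.sum_nonneg fun j _ => Finset.sum_nonneg fun k _ => mul_nonneg (hc j k) <|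
    mul_nonneg (bspline_nonneg j ξ.1.2.1 ξ.1.2.2) (bspline_nonneg k ξ.2.2.1 ξ.2.2.2)

lemma bezierFun_nonneg {c : Fin 3 → Fin 3 → ℝ} (hc : ∀ j k, 0 ≤ c j k) (ξ : UnitSquare) :
    0 ≤ bezierFun c ξ :=
  Finset.sum_nonneg fun j _ => Finset.sum_nonneg fun k _ => mul_nonneg (hc j k) <|
    mul_nonneg bernstein_nonneg bernstein_nonneg

lemma splineFun_eq_one {c : Fin 4 → Fin 4 → ℝ} (hc : ∀ j k, c j k = 1) (ξ : UnitSquare) :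
    splineFun c ξ = 1 := by
  simp [splineFun, hc, ← Finset.mul_sum, sum_bspline]

lemma bezierFun_eq_one {c : Fin 3 → Fin 3 → ℝ} (hc : ∀ j k, c j k = 1) (ξ : UnitSquare) :
    bezierFun c ξ = 1 := by
  simp only [bezierFun, hc, one_mul, ← Finset.mul_sum, sum_bernstein_two, mul_one]

lemma splineFun_eq_zero {c : Fin 4 → Fin 4 → ℝ} (hc : ∀ j k, c j k = 0) (ξ : UnitSquare) :
    splineFun c ξ = 0 := by
  simp [splineFun, hc]

lemma bezierFun_eq_zero {c : Fin 3 → Fin 3 → ℝ} (hc : ∀ j k, c j k = 0) (ξ : UnitSquare) :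
    bezierFun c ξ = 0 := by
  simp [bezierFun, hc]

lemma splineFun_add (c d : Fin 4 → Fin 4 → ℝ) (ξ : UnitSquare) :
    splineFun (fun j k => c j k + d j k) ξ = splineFun c ξ + splineFun d ξ := by
  simp [splineFun, add_mul, Finset.sum_add_distrib]

lemma splineFun_sum {ι : Type*} (s : Finset ι) (a : ι → ℝ) (c : ι → Fin 4 → Fin 4 → ℝ)
    (ξ : UnitSquare) :
    ∑ i ∈ s, a i * splineFun (c i) ξ = splineFun (fun j k => ∑ i ∈ s, a i * c i j k) ξ := by
  simp only [splineFun, Finset.mul_sum, Finset.sum_mul, mul_assoc]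
  rw [Finset.sum_comm]
  exact Finset.sum_congr rfl fun _ _ => Finset.sum_comm

lemma bezierFun_sum {ι : Type*} (s : Finset ι) (a : ι → ℝ) (c : ι → Fin 3 → Fin 3 → ℝ)
    (ξ : UnitSquare) :
    ∑ i ∈ s, a i * bezierFun (c i) ξ = bezierFun (fun j k => ∑ i ∈ s, a i * c i j k) ξ := by
  simp only [bezierFun, Finset.mul_sum, Finset.sum_mul, mul_assoc]
  rw [Finset.sum_comm]
  exact Finset.sum_congr rfl fun _ _ => Finset.sum_comm

/-- Freezing the second variable and using univariate independence in the first leaves, for each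
`j`, a univariate combination in the second variable, to which the same result applies. -/
lemma splineFun_coeff_eq_zero {c : Fin 4 → Fin 4 → ℝ} (h : ∀ ξ, splineFun c ξ = 0) (j k : Fin 4) :
    c j k = 0 := by
  have key : ∀ t : unitInterval, (fun j => ∑ k, c j k * bspline k t) = 0 := fun t =>
    bspline_coeff_eq_zero fun s => by
      rw [← h (s, t)]
      simp only [splineFun, Finset.sum_mul]
      exact Finset.sum_congr rfl fun _ _ => Finset.sum_congr rfl fun _ _ => by ring
  exact congrFun (bspline_coeff_eq_zero fun t => congrFun (key t) j) k

lemma bezierFun_coeff_eq_zero {c : Fin 3 → Fin 3 → ℝ} (h : ∀ ξ, bezierFun c ξ = 0) (j k : Fin 3) :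
    c j k = 0 := by
  have key : ∀ t : unitInterval, (fun j => ∑ k : Fin 3, c j k * bernstein 2 k t) = 0 := fun t =>
    bernstein_two_coeff_eq_zero fun s => by
      rw [← h (s, t)]
      simp only [bezierFun, Finset.sum_mul]
      exact Finset.sum_congr rfl fun _ _ => Finset.sum_congr rfl fun _ _ => by ring
  exact congrFun (bernstein_two_coeff_eq_zero fun t => congrFun (key t) j) k

lemma refine_nonneg {c : Fin 3 → Fin 3 → ℝ} (hc : ∀ a b, 0 ≤ c a b) (j k : Fin 4) :
    0 ≤ refine c j k := by
  have hK : ∀ i a, 0 ≤ knotInsertion i a := by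
    intro i a
    fin_cases i <;> fin_cases a <;> simp [knotInsertion]
  exact Finset.sum_nonneg fun a _ => Finset.sum_nonneg fun b _ =>
    smul_nonneg (mul_nonneg (hK j a) (hK k b)) (hc a b)

lemma refine_sum {ι : Type*} (s : Finset ι) (a : ι → ℝ) (c : ι → Fin 3 → Fin 3 → ℝ)
    (j k : Fin 4) :
    ∑ i ∈ s, a i * refine (c i) j k = refine (fun p q => ∑ i ∈ s, a i * c i p q) j k := by
  simp only [refine, smul_eq_mul, Finset.mul_sum]
  rw [Finset.sum_comm]
  refine Finset.sum_congr rfl fun _ _ => ?_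
  rw [Finset.sum_comm]
  exact Finset.sum_congr rfl fun _ _ => Finset.sum_congr rfl fun _ _ => by ring

lemma refine_one (j k : Fin 4) : refine (fun _ _ => (1 : ℝ)) j k = 1 := by
  fin_cases j <;> fin_cases k <;>
    simp [refine, knotInsertion, Fin.sum_univ_three] <;> norm_num

end Bivariate

/-! ### Barycentric coordinates and noncollinear points -/

section Barycentric

/-- The definition chooses some affine weights, without a sign condition. Affine independence of the
vertices makes them unique, so they agree with the nonnegative weights given by membership in the
triangle. -/
lemma barycentric_spec {m : ℕ} (t : Affine.Triangle ℝ (EuclideanSpace ℝ (Fin (m + 2))))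
    {c : EuclideanSpace ℝ (Fin (m + 2))} (hc : c ∈ t.closedInterior) :
    (∀ ν, 0 ≤ QuadMesh.barycentric t c ν) ∧ ∑ ν, QuadMesh.barycentric t c ν = 1 ∧
      c = ∑ ν, QuadMesh.barycentric t c ν • t.points ν := by
  obtain ⟨w, hw, hw0, rfl⟩ := hc
  have e : ∀ v : Fin 3 → ℝ, ∑ ν, v ν = 1 →
      Finset.univ.affineCombination ℝ t.points v = ∑ ν, v ν • t.points ν := fun v hv =>
    Finset.affineCombination_eq_linear_combination _ _ _ hv
  have hex : ∃ v : Fin 3 → ℝ, ∑ ν, v ν = 1 ∧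
      Finset.univ.affineCombination ℝ t.points w = ∑ ν, v ν • t.points ν := ⟨w, hw, e w hw⟩
  have hb : QuadMesh.barycentric t (Finset.univ.affineCombination ℝ t.points w) = hex.choose := by
    rw [QuadMesh.barycentric, dif_pos hex]
  have hspec := hex.choose_spec
  rw [hb]
  refine ⟨fun ν => ?_, hspec⟩
  have := (affineIndependent_iff_eq_of_fintype_affineCombination_eq ℝ t.points).1
    t.independent w hex.choose hw hspec.1 (hspec.2.trans (e _ hspec.1).symm)
  rw [← this]
  exact (hw0 ν).1

/-- Vectors orthogonal to `(1, 1, 1)` and to a nonconstant vector `a` are multiples of the cross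
product of these two. -/
lemma exists_eq_mul_cross {a : Fin 3 → ℝ} (ha : ¬ (a 0 = a 1 ∧ a 1 = a 2)) {x : Fin 3 → ℝ}
    (hx : ∑ ν, x ν = 0) (hax : ∑ ν, a ν * x ν = 0) :
    ∃ r : ℝ, x = fun ν => r * (![a 1 - a 2, a 2 - a 0, a 0 - a 1] : Fin 3 → ℝ) ν := by
  rw [Fin.sum_univ_three] at hx hax
  -- The factor is read off in a component where the cross product is nonzero: the first if `a 1 ≠ a
  -- 2`, otherwise the second, because `a` is not constant.
  by_cases h : a 1 = a 2
  · have h' : a 2 - a 0 ≠ 0 := fun h0 => ha ⟨by linarith, h⟩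
    have hx0 : x 0 = 0 := by
      have : (a 2 - a 0) * x 0 = 0 := by linear_combination (a 2) * hx - hax + h * x 1
      exact (mul_eq_zero.1 this).resolve_left h'
    refine ⟨x 1 / (a 2 - a 0), funext fun ν => ?_⟩
    fin_cases ν <;> simp
    · simp [h, hx0]
    · field_simp
    · field_simp; rw [h]; linear_combination (a 2 - a 0) * (hx - hx0)
  · have h' : a 1 - a 2 ≠ 0 := sub_ne_zero.2 h
    refine ⟨x 0 / (a 1 - a 2), funext fun ν => ?_⟩
    fin_cases ν <;> simp <;> field_simp
    · linear_combination hax - (a 2) * hx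
    · linear_combination (a 1) * hx - hax

/-- A linear form in the weights of the points of a noncollinear set vanishes. -/
lemma eq_zero_of_not_collinear {W : Type*} [AddCommGroup W] [Module ℝ W] {s : Set W}
    (hs : ¬ Collinear ℝ s) (p : Fin 3 → W) (w : W → Fin 3 → ℝ)
    (hw : ∀ c ∈ s, ∑ ν, w c ν = 1) (hp : ∀ c ∈ s, c = ∑ ν, w c ν • p ν) {a : Fin 3 → ℝ}
    (ha : ∀ c ∈ s, ∑ ν, a ν * w c ν = 0) : a = 0 := by
  obtain ⟨c₀, hc₀⟩ : s.Nonempty := by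
    by_contra h
    rw [Set.not_nonempty_iff_eq_empty] at h
    exact hs (h ▸ collinear_empty ℝ W)
  by_cases hconst : a 0 = a 1 ∧ a 1 = a 2
  · have h1 := hw _ hc₀
    have h2 := ha _ hc₀
    rw [Fin.sum_univ_three] at h1 h2
    have h0 : a 2 = 0 := by
      rw [hconst.1, hconst.2] at h2
      linear_combination h2 - a 2 * h1
    funext ν
    fin_cases ν <;> simp [hconst.1, hconst.2, h0]
  -- For nonconstant `a`, the difference of the weights of `c` and `c₀` is orthogonal to `a` and to
  -- `(1, 1, 1)`, hence a multiple of one fixed vector. All points then lie on one line through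
  -- `c₀`.
  · refine absurd ((collinear_iff_of_mem hc₀).2
      ⟨∑ ν, (![a 1 - a 2, a 2 - a 0, a 0 - a 1] : Fin 3 → ℝ) ν • p ν, fun c hc => ?_⟩) hs
    obtain ⟨r, hr⟩ := exists_eq_mul_cross (x := fun ν => w c ν - w c₀ ν) hconst
      (by rw [Finset.sum_sub_distrib, hw c hc, hw c₀ hc₀, sub_self])
      (by simp only [mul_sub, Finset.sum_sub_distrib, ha c hc, ha c₀ hc₀, sub_self])
    refine ⟨r, ?_⟩
    rw [vadd_eq_add, ← sub_eq_iff_eq_add]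
    conv_lhs => rw [hp c hc, hp c₀ hc₀]
    rw [← Finset.sum_sub_distrib, Finset.smul_sum]
    refine Finset.sum_congr rfl fun ν _ => ?_
    rw [← sub_smul, smul_smul]
    exact congrArg (· • p ν) (congrFun hr ν)

end Barycentric

/-! ### Incidences in a quadrilateral complex -/

namespace QuadComplex

variable {V E F : Type*} (M : QuadComplex V E F)

lemma vertInEdge_edge (σ : F) (i j : Fin 4) :
    M.VertInEdge (M.vert σ i) (M.edge σ j) ↔ i = j ∨ i = j + 1 := by
  rw [VertInEdge, M.ends_edge, Sym2.mem_iff, (M.vert_injective σ).eq_iff,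
    (M.vert_injective σ).eq_iff]

/-- Edges with the same index in `E` have the same ends, and in a cycle of length four two
consecutive vertices determine the edge between them. -/
lemma edge_injective (σ : F) : Function.Injective (M.edge σ) := by
  intro i j h
  have h1 := (M.vertInEdge_edge σ i j).1 (h ▸ (M.vertInEdge_edge σ i i).2 (Or.inl rfl))
  have h2 := (M.vertInEdge_edge σ (i + 1) j).1 (h ▸ (M.vertInEdge_edge σ (i + 1) i).2 (Or.inr rfl))
  clear h
  revert i j
  decide

variable {M}

lemma VertInEdge.vertInFace {γ : V} {τ : E} {σ : F} (h : M.VertInEdge γ τ)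
    (hτ : M.EdgeInFace τ σ) : M.VertInFace γ σ := by
  obtain ⟨i, rfl⟩ := hτ
  rw [VertInEdge, M.ends_edge, Sym2.mem_iff] at h
  exact h.elim (fun e => ⟨i, e.symm⟩) fun e => ⟨i + 1, e.symm⟩

/-- A face containing `γ` has exactly two edges at `γ`. -/
lemma ncard_edges_at {γ : V} {σ : F} (h : M.VertInFace γ σ) :
    {τ | M.VertInEdge γ τ ∧ M.EdgeInFace τ σ}.ncard = 2 := by
  obtain ⟨i, rfl⟩ := h
  -- Modulo four, `i + 3` is `i - 1`: the edges at vertex `i` are the one starting and the one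
  -- ending there.
  have : {τ | M.VertInEdge (M.vert σ i) τ ∧ M.EdgeInFace τ σ}
      = {M.edge σ i, M.edge σ (i + 3)} := by
    ext τ
    constructor
    · rintro ⟨h, j, rfl⟩
      rw [vertInEdge_edge] at h
      rcases h with rfl | rfl
      · exact Or.inl rfl
      · right
        rw [Set.mem_singleton_iff, add_assoc]
        exact congrArg _ (by simp)
    · rintro (rfl | rfl)
      · exact ⟨(M.vertInEdge_edge σ _ _).2 (Or.inl rfl), _, rfl⟩
      · exact ⟨(M.vertInEdge_edge σ _ _).2 (Or.inr (by rw [add_assoc]; simp)), _, rfl⟩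
  rw [this, Set.ncard_pair]
  intro h
  simpa using M.edge_injective σ h

lemma edgeValence_pos [Finite F] (τ : E) : 0 < M.edgeValence τ := by
  obtain ⟨σ, i, h⟩ := M.edge_cover τ
  exact (Set.ncard_pos (Set.toFinite _)).2 ⟨σ, i, h⟩

lemma vertValence_pos [Finite F] (γ : V) : 0 < M.vertValence γ := by
  obtain ⟨σ, i, h⟩ := M.vert_cover γ
  exact (Set.ncard_pos (Set.toFinite _)).2 ⟨σ, i, h⟩

/-- Every face containing an edge at `γ` contains `γ`, so that edge has valence at most one. -/
lemma IsCorner.isBoundaryVertex [Finite F] {γ : V} (h : M.IsCorner γ) :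
    M.IsBoundaryVertex γ := by
  obtain ⟨σ, i, rfl⟩ := M.vert_cover γ
  have hv : M.VertInEdge (M.vert σ i) (M.edge σ i) := (M.vertInEdge_edge σ i i).2 (Or.inl rfl)
  refine ⟨M.edge σ i, le_antisymm ?_ (edgeValence_pos _), hv⟩
  rw [← h]
  exact Set.ncard_le_ncard (fun σ' h' => hv.vertInFace h') (Set.toFinite _)

lemma IsCorner.not_isExtraordinary [Finite F] {γ : V} (h : M.IsCorner γ) :
    ¬ M.IsExtraordinary γ := by
  rintro (h' | h')
  · exact h'.1 h.isBoundaryVertex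
  · have := h'.2
    rw [h] at this
    omega

end QuadComplex

/-! ### The star of a vertex and its boundary edges -/

namespace QuadMesh

variable {V E F : Type*} (M : QuadMesh V E F)

open QuadComplex

/-- The faces around `γ`, adjacent if they share an interior edge at `γ`. -/
def starGraph (γ : V) : SimpleGraph {σ : F // M.VertInFace γ σ} where
  Adj σ σ' := σ ≠ σ' ∧ M.AdjacentAt γ σ σ'
  symm := ⟨fun _ _ ⟨h, τ, h1, h2, h3, h4⟩ => ⟨h.symm, τ, h1, h2, h4, h3⟩⟩
  loopless := ⟨fun _ h => h.1 rfl⟩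

/-- Chains of faces may pause, since a face can be adjacent to itself in the sense of `AdjacentAt`;
such steps are dropped. All faces of a chain starting in the star stay in it, because the shared
edges contain `γ`. -/
lemma starGraph_connected (γ : V) : (M.starGraph γ).Connected := by
  have key : ∀ σ σ', (hσ : M.VertInFace γ σ) → Relation.ReflTransGen (M.AdjacentAt γ) σ σ' →
      ∃ hσ' : M.VertInFace γ σ', (M.starGraph γ).Reachable ⟨σ, hσ⟩ ⟨σ', hσ'⟩ := by
    intro σ σ' hσ h
    induction h with
    | refl => exact ⟨hσ, .refl _⟩
    | @tail b c _ hbc ih =>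
      obtain ⟨hb, hr⟩ := ih
      have hc : M.VertInFace γ c := hbc.choose_spec.2.1.vertInFace hbc.choose_spec.2.2.2
      refine ⟨hc, ?_⟩
      by_cases e : b = c
      · subst e
        exact hr
      · exact hr.trans (SimpleGraph.Adj.reachable ⟨fun h => e (congrArg Subtype.val h), hbc⟩)
  obtain ⟨σ, hσ⟩ := M.vert_cover γ
  have : Nonempty {σ : F // M.VertInFace γ σ} := ⟨⟨σ, hσ⟩⟩
  exact ⟨fun a b => (key a b a.2 (M.no_kissing γ a b a.2 b.2)).2⟩

lemma eq_or_eq_of_edgeInFace [Finite F] {τ : E} {a b c d : F} (hab : a ≠ b) (hcd : c ≠ d)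
    (ha : M.EdgeInFace τ a) (hb : M.EdgeInFace τ b) (hc : M.EdgeInFace τ c)
    (hd : M.EdgeInFace τ d) : s(a, b) = s(c, d) := by
  have h : ∀ {x y : F}, x ≠ y → M.EdgeInFace τ x → M.EdgeInFace τ y →
      ({x, y} : Set F) = {σ | M.EdgeInFace τ σ} := fun {x y} hxy hx hy =>
    Set.eq_of_subset_of_ncard_le (by rintro z (rfl | rfl) <;> assumption)
      (by rw [Set.ncard_pair hxy]; exact M.edgeValence_le_two τ) (Set.toFinite _)
  have e := (h hab ha hb).trans (h hcd hc hd).symm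
  rw [Sym2.eq_iff]
  exact Set.pair_eq_pair_iff.1 e

/-- Each adjacency chooses a shared interior edge, and that edge, lying in at most two faces,
determines the adjacent pair. Equality can fail, since two faces may share two edges at `γ`. -/
lemma card_starGraph_edgeSet_le [Finite E] [Finite F] (γ : V) :
    Nat.card (M.starGraph γ).edgeSet
      ≤ Nat.card {τ : E // ¬ M.IsBoundaryEdge τ ∧ M.VertInEdge γ τ} := by
  have hex : ∀ e : (M.starGraph γ).edgeSet, ∃ τ : {τ : E // ¬ M.IsBoundaryEdge τ ∧ M.VertInEdge γ τ},
      ∃ a b : {σ : F // M.VertInFace γ σ}, e.1 = s(a, b) ∧ a ≠ b ∧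
        M.EdgeInFace τ.1 a ∧ M.EdgeInFace τ.1 b := by
    rintro ⟨e, he⟩
    induction e with
    | _ a b =>
      obtain ⟨hab, τ, h1, h2, h3, h4⟩ := he
      exact ⟨⟨τ, h1, h2⟩, a, b, rfl, hab, h3, h4⟩
  choose f hf using hex
  refine Nat.card_le_card_of_injective f fun e e' h => ?_
  obtain ⟨a, b, h1, h2, h3, h4⟩ := hf e
  obtain ⟨a', b', h1', h2', h3', h4'⟩ := hf e'
  rw [← h] at h3' h4'
  have := M.eq_or_eq_of_edgeInFace (fun h => h2 (Subtype.ext h)) (fun h => h2' (Subtype.ext h))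
    h3 h4 h3' h4'
  apply Subtype.ext
  rw [h1, h1']
  exact Sym2.map.injective Subtype.val_injective this

open Classical in
/-- Every boundary vertex lies on exactly two boundary edges. -/
lemma card_boundaryEdges_at [Fintype V] [Fintype E] [Fintype F] {γ : V}
    (hγ : M.IsBoundaryVertex γ) :
    (Finset.univ.filter fun τ => M.IsBoundaryEdge τ ∧ M.VertInEdge γ τ).card = 2 := by
  set B := Finset.univ.filter fun τ => M.IsBoundaryEdge τ ∧ M.VertInEdge γ τ
  set I := Finset.univ.filter fun τ => ¬ M.IsBoundaryEdge τ ∧ M.VertInEdge γ τ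
  set S := Finset.univ.filter fun σ => M.VertInFace γ σ
  set T := Finset.univ.filter fun τ => M.VertInEdge γ τ
  have hpos : 0 < B.card := by
    obtain ⟨τ, h⟩ := hγ
    exact Finset.card_pos.2 ⟨τ, by simpa [B] using h⟩
  -- A connected graph has at most one vertex more than it has edges.
  have htree : S.card ≤ I.card + 1 := by
    have h1 := (M.starGraph_connected γ).card_vert_le_card_edgeSet_add_one
    have h2 := M.card_starGraph_edgeSet_le γ
    have h3 : Nat.card {σ : F // M.VertInFace γ σ} = S.card := by
      rw [Nat.card_eq_fintype_card, Fintype.card_subtype]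
    have h4 : Nat.card {τ : E // ¬ M.IsBoundaryEdge τ ∧ M.VertInEdge γ τ} = I.card := by
      rw [Nat.card_eq_fintype_card, Fintype.card_subtype]
    omega
  -- Incident pairs of faces and edges at `γ` are counted twice: a face has two edges at `γ`, and an
  -- edge lies in one or two faces.
  have hcount : 2 * S.card = B.card + 2 * I.card := by
    have h := Finset.sum_card_bipartiteAbove_eq_sum_card_bipartiteBelow
      (s := S) (t := T) (fun σ τ => M.EdgeInFace τ σ)
    have hS : ∀ σ ∈ S, (T.bipartiteAbove (fun σ τ => M.EdgeInFace τ σ) σ).card = 2 := by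
      intro σ hσ
      rw [← ncard_edges_at (M := M.toQuadComplex) (γ := γ) (σ := σ) (by simpa [S] using hσ),
        ← Set.ncard_coe_finset]
      congr 1
      ext τ
      simp [T]
    have hT : ∀ τ ∈ T, (S.bipartiteBelow (fun σ τ => M.EdgeInFace τ σ) τ).card
        = if M.IsBoundaryEdge τ then 1 else 2 := by
      intro τ hτ
      have hτ' : M.VertInEdge γ τ := by simpa [T] using hτ
      have : (S.bipartiteBelow (fun σ τ => M.EdgeInFace τ σ) τ).card = M.edgeValence τ := by
        rw [edgeValence, ← Set.ncard_coe_finset]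
        congr 1
        ext σ
        simpa [S] using fun h => hτ'.vertInFace h
      rw [this]
      split_ifs with hb
      · exact hb
      · have h1 := M.edgeValence_le_two τ
        have h2 : 0 < M.edgeValence τ := edgeValence_pos τ
        unfold IsBoundaryEdge at hb
        omega
    rw [Finset.sum_congr rfl hS, Finset.sum_congr rfl hT, Finset.sum_ite, Finset.sum_const,
      Finset.sum_const, Finset.sum_const, Finset.filter_filter, Finset.filter_filter] at h
    simp only [and_comm (a := M.VertInEdge γ _)] at h
    simp only [smul_eq_mul] at h
    linarith
  -- `B.card` is positive, even by `hcount`, and at most two by `htree`.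
  omega

/-! ### The coefficients of the functions `B*_φ` -/

variable {M}

lemma starCoeff_nonneg (φ : M.StarDof) (D : V ⊕ E ⊕ F) : 0 ≤ M.starCoeff φ D := by
  rcases φ with _ | _ | _ <;> rcases D with _ | _ | _ <;> simp only [starCoeff, le_refl] <;>
    split_ifs <;> positivity

open Classical in
lemma sum_starDof [Fintype V] [Fintype E] [Fintype F] (f : M.StarDof → ℝ) :
    ∑ φ, f φ = ∑ σ, f (.inl σ) + (∑ τ, f (.inr (.inl τ)) + ∑ γ, f (.inr (.inr γ))) := by
  rw [← Fintype.sum_sum_type fun x => f (.inr x), ← Fintype.sum_sum_type]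
  exact Finset.sum_congr (by ext; simp) fun _ _ => rfl

lemma sum_starCoeff_face [Fintype V] [Fintype E] [Fintype F] (σ : F) :
    ∑ φ, M.starCoeff φ (.inr (.inr σ)) = 1 := by
  classical
  simp [sum_starDof, starCoeff]

lemma sum_starCoeff_edge [Fintype V] [Fintype E] [Fintype F] (τ : E) :
    ∑ φ, M.starCoeff φ (.inr (.inl τ)) = 1 := by
  classical
  rw [sum_starDof]
  simp only [starCoeff, Finset.sum_const_zero, add_zero]
  by_cases h : M.IsBoundaryEdge τ
  · rw [Fintype.sum_eq_single ⟨τ, h⟩ fun τ' hτ' => if_neg fun e => hτ' (Subtype.ext e.symm)]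
    simp [h]
  · have h1 : ∀ τ' : {τ // M.IsBoundaryEdge τ}, (if τ = τ'.1 then (1 : ℝ) else 0) = 0 :=
      fun τ' => if_neg fun e : τ = τ'.1 => h (e ▸ τ'.2)
    have h2 : (Finset.univ.filter fun σ => M.EdgeInFace τ σ).card = 2 := by
      have h3 : (Finset.univ.filter fun σ => M.EdgeInFace τ σ).card = M.edgeValence τ := by
        rw [edgeValence, ← Set.ncard_coe_finset]
        congr 1
        ext σ
        simp
      have h4 := M.edgeValence_le_two τ
      have h5 : 0 < M.edgeValence τ := edgeValence_pos τ
      unfold IsBoundaryEdge at h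
      omega
    simp [h1, h, ← Finset.sum_filter, h2]

/-- An interior vertex receives `1/μ` from each of its `μ` faces, a corner receives `1` from its own
function, and any other boundary vertex receives `1/2` from each of its two boundary edges. -/
lemma sum_starCoeff_vert [Fintype V] [Fintype E] [Fintype F] (γ : V) :
    ∑ φ, M.starCoeff φ (.inl γ) = 1 := by
  classical
  rw [sum_starDof]
  simp only [starCoeff]
  by_cases hb : M.IsBoundaryVertex γ
  · by_cases hc : M.IsCorner γ
    · rw [Fintype.sum_eq_single (f := fun γ' : {γ // M.IsCorner γ} => if γ = γ'.1 then (1 : ℝ) else 0)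
        ⟨γ, hc⟩ fun γ' h => if_neg fun e => h (Subtype.ext e.symm)]
      simp [hb, hc]
    · have h1 : ∀ γ' : {γ // M.IsCorner γ}, (if γ = γ'.1 then (1 : ℝ) else 0) = 0 :=
        fun γ' => if_neg fun e : γ = γ'.1 => hc (e ▸ γ'.2)
      have h2 := M.card_boundaryEdges_at hb
      rw [← Finset.filter_filter] at h2
      simp only [h1, hb, hc, not_true_eq_false, and_false, if_false, Finset.sum_const_zero,
        not_false_eq_true, and_true, add_zero, zero_add]
      rw [← Finset.sum_subtype (Finset.univ.filter fun τ => M.IsBoundaryEdge τ) (by simp)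
        fun τ => if M.VertInEdge γ τ then (1 / 2 : ℝ) else 0, ← Finset.sum_filter]
      simp [h2]
  · have hc : ¬ M.IsCorner γ := fun h => hb h.isBoundaryVertex
    have h1 : ∀ γ' : {γ // M.IsCorner γ}, (if γ = γ'.1 then (1 : ℝ) else 0) = 0 :=
      fun γ' => if_neg fun e : γ = γ'.1 => hc (e ▸ γ'.2)
    have h2 : ∀ τ : {τ // M.IsBoundaryEdge τ},
        (if M.VertInEdge γ τ.1 ∧ ¬ M.IsCorner γ then (1 / 2 : ℝ) else 0) = 0 :=
      fun τ => if_neg fun e => hb ⟨τ, τ.2, e.1⟩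
    have h3 : (Finset.univ.filter fun σ => M.VertInFace γ σ).card = M.vertValence γ := by
      rw [vertValence, ← Set.ncard_coe_finset]
      congr 1
      ext σ
      simp
    have h4 : (M.vertValence γ : ℝ) ≠ 0 :=
      Nat.cast_ne_zero.2 (vertValence_pos (M := M.toQuadComplex) γ).ne'
    rw [Finset.sum_congr rfl fun τ _ => h2 τ]
    simp [h1, hb, ← Finset.sum_filter, h3, h4]

lemma sum_starCoeff [Fintype V] [Fintype E] [Fintype F] (D : V ⊕ E ⊕ F) :
    ∑ φ, M.starCoeff φ D = 1 := by
  rcases D with γ | τ | σ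
  · exact sum_starCoeff_vert γ
  · exact sum_starCoeff_edge τ
  · exact sum_starCoeff_face σ

end QuadMesh

namespace QuadMesh

open QuadComplex

variable {V E F : Type*} {M : QuadMesh V E F}

/-! ### Domain points near a vertex and truncation -/

variable (M) in
/-- The domain points of `σ` that influence the refined coefficients at the `i`-th vertex. -/
def nearPoints (σ : F) (i : Fin 4) : Set (V ⊕ E ⊕ F) :=
  {.inl (M.vert σ i), .inr (.inl (M.edge σ i)), .inr (.inl (M.edge σ (i + 3))), .inr (.inr σ)}

lemma exists_domainPoint_mem_nearPoints (σ : F) (p q : Fin 3) :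
    ∃ i, M.domainPoint σ p q ∈ M.nearPoints σ i := by
  fin_cases p <;> fin_cases q
  · exact ⟨0, by simp [domainPoint, nearPoints]⟩
  · exact ⟨3, by simp [domainPoint, nearPoints]⟩
  · exact ⟨3, by simp [domainPoint, nearPoints]⟩
  · exact ⟨0, by simp [domainPoint, nearPoints]⟩
  · exact ⟨0, by simp [domainPoint, nearPoints]⟩
  · exact ⟨2, by simp [domainPoint, nearPoints]⟩
  · exact ⟨1, by simp [domainPoint, nearPoints]⟩
  · exact ⟨1, by simp [domainPoint, nearPoints]⟩
  · exact ⟨2, by simp [domainPoint, nearPoints]⟩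

lemma exists_domainPoint_eq {σ : F} {i : Fin 4} {D : V ⊕ E ⊕ F} (hD : D ∈ M.nearPoints σ i) :
    ∃ p q, M.domainPoint σ p q = D := by
  have hv : ∀ i, ∃ p q, M.domainPoint σ p q = .inl (M.vert σ i) := by
    intro i
    fin_cases i
    exacts [⟨0, 0, rfl⟩, ⟨2, 0, rfl⟩, ⟨2, 2, rfl⟩, ⟨0, 2, rfl⟩]
  have he : ∀ i, ∃ p q, M.domainPoint σ p q = .inr (.inl (M.edge σ i)) := by
    intro i
    fin_cases i
    exacts [⟨1, 0, rfl⟩, ⟨2, 1, rfl⟩, ⟨1, 2, rfl⟩, ⟨0, 1, rfl⟩]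
  rcases hD with rfl | rfl | rfl | rfl
  · exact hv i
  · exact he i
  · exact he _
  · exact ⟨1, 1, rfl⟩

/-- The first two rows of `K` vanish in the last column and the last two rows in the first column,
so a block sees only a `2 × 2` array of unrefined coefficients. -/
lemma refine_eq_zero_of_nearPoints {f : V ⊕ E ⊕ F → ℝ} {σ : F} {j k : Fin 4}
    (h : ∀ D ∈ M.nearPoints σ (nearestVertex j k), f D = 0) :
    refine (fun p q => f (M.domainPoint σ p q)) j k = 0 := by
  simp only [nearPoints, Set.mem_insert_iff, Set.mem_singleton_iff, forall_eq_or_imp,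
    forall_eq] at h
  obtain ⟨h1, h2, h3, h4⟩ := h
  fin_cases j <;> fin_cases k <;> simp [nearestVertex] at h1 h2 h3 h4 <;>
    simp [refine, knotInsertion, Fin.sum_univ_three, domainPoint, h1, h2, h3, h4]

/-- Converse of the preceding lemma: the relevant `2 × 2` parts of `K` are triangular with diagonal
entries `1` and `1/2`, hence invertible. -/
lemma nearPoints_eq_zero_of_refine {f : V ⊕ E ⊕ F → ℝ} {σ : F} {i : Fin 4}
    (h : ∀ j k, nearestVertex j k = i → refine (fun p q => f (M.domainPoint σ p q)) j k = 0) :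
    ∀ D ∈ M.nearPoints σ i, f D = 0 := by
  simp only [nearPoints, Set.mem_insert_iff, Set.mem_singleton_iff, forall_eq_or_imp,
    forall_eq]
  fin_cases i
  · have h1 := h 0 0 rfl
    have h2 := h 0 1 rfl
    have h3 := h 1 0 rfl
    have h4 := h 1 1 rfl
    simp [refine, knotInsertion, Fin.sum_univ_three, domainPoint] at h1 h2 h3 h4 ⊢
    refine ⟨?_, ?_, ?_, ?_⟩ <;> linarith
  · have h1 := h 3 0 rfl
    have h2 := h 3 1 rfl
    have h3 := h 2 0 rfl
    have h4 := h 2 1 rfl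
    simp [refine, knotInsertion, Fin.sum_univ_three, domainPoint] at h1 h2 h3 h4 ⊢
    refine ⟨?_, ?_, ?_, ?_⟩ <;> linarith
  · have h1 := h 3 3 rfl
    have h2 := h 3 2 rfl
    have h3 := h 2 3 rfl
    have h4 := h 2 2 rfl
    simp [refine, knotInsertion, Fin.sum_univ_three, domainPoint] at h1 h2 h3 h4 ⊢
    refine ⟨?_, ?_, ?_, ?_⟩ <;> linarith
  · have h1 := h 0 3 rfl
    have h2 := h 0 2 rfl
    have h3 := h 1 3 rfl
    have h4 := h 1 2 rfl
    simp [refine, knotInsertion, Fin.sum_univ_three, domainPoint] at h1 h2 h3 h4 ⊢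
    refine ⟨?_, ?_, ?_, ?_⟩ <;> linarith

open Classical in
lemma prod_truncation (σ : F) (j k : Fin 4) :
    ∏ i, M.truncation σ i j k
      = if M.IsExtraordinary (M.vert σ (nearestVertex j k)) then 0 else 1 := by
  rw [Finset.prod_eq_single (nearestVertex j k)]
  · simp [truncation]
  · intro i _ hi
    simp [truncation, hi.symm]
  · simp

lemma isExtraordinaryFace_of_vert {σ : F} {i : Fin 4} (h : M.IsExtraordinary (M.vert σ i)) :
    M.IsExtraordinaryFace σ :=
  ⟨_, ⟨i, rfl⟩, h⟩

/-- The vertex `γ` lies in the face, edge or vertex `φ`. -/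
def StarMem (γ : V) : M.StarDof → Prop
  | .inl σ => M.VertInFace γ σ
  | .inr (.inl τ) => M.VertInEdge γ τ.1
  | .inr (.inr γ') => γ' = γ

/-- A nonzero coefficient of `B*_φ` sits at a cell contained in `φ`, whereas every near point of a
vertex is a cell containing that vertex. -/
lemma starCoeff_eq_zero {φ : M.StarDof} {σ : F} {i : Fin 4} (h : ¬ StarMem (M.vert σ i) φ) :
    ∀ D ∈ M.nearPoints σ i, M.starCoeff φ D = 0 := by
  have e1 : M.VertInEdge (M.vert σ i) (M.edge σ i) := (vertInEdge_edge _ _ _ _).2 (.inl rfl)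
  have e2 : M.VertInEdge (M.vert σ i) (M.edge σ (i + 3)) :=
    (vertInEdge_edge _ _ _ _).2 (.inr (by rw [add_assoc]; simp))
  rcases φ with φ | τ | γ <;> simp only [StarMem] at h <;> rintro D (rfl | rfl | rfl | rfl)
  · exact if_neg fun h' => h h'.1
  · exact if_neg fun h' => h (e1.vertInFace h'.1)
  · exact if_neg fun h' => h (e2.vertInFace h'.1)
  · exact if_neg fun h' : σ = φ => h (h' ▸ ⟨i, rfl⟩)
  · exact if_neg fun h' => h h'.1
  · exact if_neg fun h' : _ = τ.1 => h (h' ▸ e1)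
  · exact if_neg fun h' : _ = τ.1 => h (h' ▸ e2)
  · rfl
  · exact if_neg fun h' => h h'.symm
  · rfl
  · rfl
  · rfl

/-- `B_φ` vanishes on a face all of whose vertices in `φ` are extraordinary. -/
lemma truncatedFun_eq_zero {φ : M.StarDof} {σ : F}
    (h : ∀ i, StarMem (M.vert σ i) φ → M.IsExtraordinary (M.vert σ i)) (ξ : UnitSquare) :
    M.truncatedFun φ σ ξ = 0 := by
  rw [truncatedFun]
  split_ifs with hσ
  · refine splineFun_eq_zero (fun j k => ?_) ξ
    rw [prod_truncation]
    split_ifs with hγ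
    · exact mul_zero _
    · rw [mul_one]
      exact refine_eq_zero_of_nearPoints (f := M.starCoeff φ)
        (starCoeff_eq_zero fun hm => hγ (h _ hm))
  -- On a regular face the hypothesis says that no vertex of `σ` lies in `φ`, and the near points of
  -- the four vertices exhaust the domain points.
  · refine bezierFun_eq_zero (fun p q => ?_) ξ
    obtain ⟨i, hi⟩ := exists_domainPoint_mem_nearPoints (M := M) σ p q
    exact starCoeff_eq_zero (fun hm => hσ (isExtraordinaryFace_of_vert (h i hm))) _ hi

lemma truncatedFun_nonneg (φ : M.StarDof) (σ : F) (ξ : UnitSquare) :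
    0 ≤ M.truncatedFun φ σ ξ := by
  rw [truncatedFun]
  split_ifs
  · refine splineFun_nonneg (fun j k => ?_) ξ
    rw [prod_truncation]
    refine mul_nonneg (refine_nonneg (fun p q => starCoeff_nonneg φ _) j k) ?_
    split_ifs <;> norm_num
  · exact bezierFun_nonneg (fun p q => starCoeff_nonneg φ _) ξ

/-! ### Boundary values of face functions -/

/-- On a side of the square only the outermost coefficients are active. Since the outer rows of `K`
are unit vectors, these depend only on the three domain points of that side; truncation merely
multiplies by `0` or `1`. -/
lemma truncatedFun_eq_zero_of_edge {φ : M.StarDof} {σ : F} {i : Fin 4}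
    (h1 : M.starCoeff φ (.inl (M.vert σ i)) = 0)
    (h2 : M.starCoeff φ (.inl (M.vert σ (i + 1))) = 0)
    (h3 : M.starCoeff φ (.inr (.inl (M.edge σ i))) = 0) {ξ : UnitSquare}
    (hξ : OnLocalEdge i ξ) : M.truncatedFun φ σ ξ = 0 := by
  obtain ⟨s, t⟩ := ξ
  rw [truncatedFun]
  split_ifs
  · fin_cases i <;> simp [OnLocalEdge] at hξ h1 h2 h3 <;> subst hξ <;>
      simp [splineFun, Fin.sum_univ_four, bspline_zero, bspline_one, refine, knotInsertion,
        Fin.sum_univ_three, localStarCoeff, domainPoint, h1, h2, h3]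
  · fin_cases i <;> simp [OnLocalEdge] at hξ h1 h2 h3 <;> subst hξ <;>
      simp [bezierFun, Fin.sum_univ_three, bernstein_apply, localStarCoeff, domainPoint,
        h1, h2, h3]

lemma truncatedFun_localVertex_eq_zero {φ : M.StarDof} {σ : F} {i : Fin 4}
    (h : M.starCoeff φ (.inl (M.vert σ i)) = 0) :
    M.truncatedFun φ σ (localVertex i) = 0 := by
  rw [truncatedFun]
  split_ifs
  · fin_cases i <;> simp at h <;>
      simp [localVertex, splineFun, bspline_zero, bspline_one, refine,
        knotInsertion, Fin.sum_univ_three, localStarCoeff, domainPoint, h]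
  · fin_cases i <;> simp at h <;>
      simp [localVertex, bezierFun, Fin.sum_univ_three, bernstein_apply, localStarCoeff,
        domainPoint, h]

lemma starCoeff_face_boundaryVertex (φ : F) {γ : V} (h : M.IsBoundaryVertex γ) :
    M.starCoeff (.inl φ) (.inl γ) = 0 :=
  if_neg fun h' => h'.2 h

lemma starCoeff_face_boundaryEdge (φ : F) {τ : E} (h : M.IsBoundaryEdge τ) :
    M.starCoeff (.inl φ) (.inr (.inl τ)) = 0 :=
  if_neg fun h' => h'.2 h

/-! ### Counting degrees of freedom -/

lemma card_dof [Fintype V] [Fintype E] [Fintype F] :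
    Nat.card M.Dof = Nat.card {σ : F // ∃ γ, ¬ M.IsExtraordinary γ ∧ M.VertInFace γ σ}
      + Nat.card {τ : E // M.IsBoundaryEdge τ ∧ ∃ γ, ¬ M.IsExtraordinary γ ∧ M.VertInEdge γ τ}
      + Nat.card {γ : V // M.IsCorner γ} + 3 * Nat.card M.ExtraVert := by
  rw [Nat.card_sum, Nat.card_sum, Nat.card_sum, Nat.card_prod, Nat.card_eq_fintype_card (α := Fin 3),
    Fintype.card_fin]
  ring

lemma card_dof_le [Fintype V] [Fintype E] [Fintype F] :
    Nat.card M.Dof ≤ Nat.card F + Nat.card {τ : E // M.IsBoundaryEdge τ}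
      + Nat.card {γ : V // M.IsCorner γ} + 3 * Nat.card M.ExtraVert := by
  rw [card_dof]
  gcongr
  · exact Finite.card_subtype_le _
  · exact Nat.card_le_card_of_injective (fun τ => ⟨τ.1, τ.2.1⟩)
      fun τ τ' h => Subtype.ext (Subtype.mk.inj h)

lemma card_dof_eq [Fintype V] [Fintype E] [Fintype F]
    (hF : ∀ σ : F, ¬ ∀ γ, M.VertInFace γ σ → M.IsExtraordinary γ)
    (hE : ∀ τ : E, M.IsBoundaryEdge τ → ¬ ∀ γ, M.VertInEdge γ τ → M.IsExtraordinary γ) :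
    Nat.card M.Dof = Nat.card F + Nat.card {τ : E // M.IsBoundaryEdge τ}
      + Nat.card {γ : V // M.IsCorner γ} + 3 * Nat.card M.ExtraVert := by
  rw [card_dof, Nat.card_congr (Equiv.subtypeUnivEquiv fun σ => ?_),
    Nat.card_congr (Equiv.subtypeEquivRight fun τ => and_iff_left_of_imp fun hτ => ?_)]
  · have := hE τ hτ
    push Not at this
    obtain ⟨γ, h1, h2⟩ := this
    exact ⟨γ, h2, h1⟩
  · have := hF σ
    push Not at this
    obtain ⟨γ, h1, h2⟩ := this
    exact ⟨γ, h2, h1⟩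

open Classical in
lemma sum_dof [Fintype V] [Fintype E] [Fintype F] (f : M.Dof → ℝ) :
    ∑ φ, f φ = ∑ σ, f (.inl σ) + (∑ τ, f (.inr (.inl τ)) + (∑ γ, f (.inr (.inr (.inl γ)))
      + ∑ γ, ∑ ν, f (.inr (.inr (.inr (γ, ν)))))) := by
  rw [← Fintype.sum_prod_type' fun γ ν => f (.inr (.inr (.inr (γ, ν)))),
    ← Fintype.sum_sum_type fun x => f (.inr (.inr x)),
    ← Fintype.sum_sum_type fun x => f (.inr x), ← Fintype.sum_sum_type]
  exact Finset.sum_congr (by ext; simp) fun _ _ => rfl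

open Classical in
/-- A sum over `𝓘` in terms of a sum over `𝓘*` whose terms vanish on `𝓘* \ 𝓘`. -/
lemma sum_dof_eq_sum_starDof [Fintype V] [Fintype E] [Fintype F] {f : M.Dof → ℝ}
    {g : M.StarDof → ℝ} (hF : ∀ σ, f (.inl σ) = g (.inl σ.1))
    (hE : ∀ τ, f (.inr (.inl τ)) = g (.inr (.inl ⟨τ.1, τ.2.1⟩)))
    (hC : ∀ γ, f (.inr (.inr (.inl γ))) = g (.inr (.inr γ)))
    (hg : ∀ φ, (∀ γ, StarMem γ φ → M.IsExtraordinary γ) → g φ = 0) :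
    ∑ φ, f φ = ∑ φ, g φ + ∑ γ, ∑ ν, f (.inr (.inr (.inr (γ, ν)))) := by
  rw [sum_dof, sum_starDof, add_assoc, add_assoc]
  refine congrArg₂ (· + ·) ?_ (congrArg₂ (· + ·) ?_ (congrArg₂ (· + ·) ?_ rfl))
  · refine Fintype.sum_of_injective Subtype.val Subtype.val_injective _
      (fun σ => g (.inl σ)) (fun σ hσ => ?_) hF
    refine hg _ fun γ hγ => ?_
    by_contra h
    exact hσ ⟨⟨σ, γ, h, hγ⟩, rfl⟩
  · refine Fintype.sum_of_injective
      (fun τ : {τ : E // M.IsBoundaryEdge τ ∧ ∃ γ, ¬ M.IsExtraordinary γ ∧ M.VertInEdge γ τ} =>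
        (⟨τ.1, τ.2.1⟩ : {τ : E // M.IsBoundaryEdge τ}))
      (fun τ τ' h => Subtype.ext (Subtype.mk.inj h)) _
      (fun τ => g (.inr (.inl τ))) (fun τ hτ => ?_) hE
    refine hg _ fun γ hγ => ?_
    by_contra h
    exact hτ ⟨⟨τ.1, τ.2, γ, h, hγ⟩, rfl⟩
  · exact Finset.sum_congr rfl fun γ _ => hC γ

/-! ### Linear combinations of basis functions -/

open Classical in
lemma sum_truncatedFun [Fintype V] [Fintype E] [Fintype F] (a : M.StarDof → ℝ) (σ : F)
    (ξ : UnitSquare) : ∑ φ, a φ * M.truncatedFun φ σ ξ =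
      if M.IsExtraordinaryFace σ then splineFun (fun j k =>
        if M.IsExtraordinary (M.vert σ (nearestVertex j k)) then 0 else
          refine (fun p q => ∑ φ, a φ * M.starCoeff φ (M.domainPoint σ p q)) j k) ξ
      else bezierFun (fun p q => ∑ φ, a φ * M.starCoeff φ (M.domainPoint σ p q)) ξ := by
  simp only [truncatedFun]
  split_ifs
  · rw [splineFun_sum]
    congr 1
    funext j k
    simp only [prod_truncation]
    split_ifs
    · simp
    · simp only [mul_one]
      exact refine_sum _ _ _ _ _
  · exact bezierFun_sum _ _ _ _

/-! ### Vertex functions, partition of unity and linear independence -/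

namespace Geometry.ControlTriangles

variable [Fintype V] [Fintype E] [Fintype F] {m : ℕ} {G : M.Geometry m} (T : G.ControlTriangles)

lemma barycentric_spec (γ : M.ExtraVert) {σ : F} {j k : Fin 4}
    (h : M.vert σ (nearestVertex j k) = γ.1) :
    (∀ ν, 0 ≤ barycentric (T.tri γ) (G.proj γ (G.refinedCoeff σ j k)) ν) ∧
      ∑ ν, barycentric (T.tri γ) (G.proj γ (G.refinedCoeff σ j k)) ν = 1 ∧
      G.proj γ (G.refinedCoeff σ j k)
        = ∑ ν, barycentric (T.tri γ) (G.proj γ (G.refinedCoeff σ j k)) ν • (T.tri γ).points ν :=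
  AlmostC1.barycentric_spec _ (T.covers γ ⟨σ, j, k, h, rfl⟩)

lemma vertexFun_nonneg (γ : M.ExtraVert) (ν : Fin 3) (σ : F) (ξ : UnitSquare) :
    0 ≤ T.vertexFun γ ν σ ξ := by
  refine splineFun_nonneg (fun j k => ?_) ξ
  split_ifs with h
  · exact (T.barycentric_spec γ h).1 ν
  · exact le_rfl

lemma vertexFun_eq_zero {γ : M.ExtraVert} {σ : F} (h : ¬ M.VertInFace γ.1 σ) (ν : Fin 3)
    (ξ : UnitSquare) : T.vertexFun γ ν σ ξ = 0 := by
  exact splineFun_eq_zero (fun j k => if_neg fun h' => h ⟨_, h'⟩) ξ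

lemma basisFun_nonneg (φ : M.Dof) (σ : F) (ξ : UnitSquare) : 0 ≤ T.basisFun φ σ ξ := by
  rcases φ with _ | _ | _ | ⟨γ, ν⟩
  · exact truncatedFun_nonneg _ _ _
  · exact truncatedFun_nonneg _ _ _
  · exact truncatedFun_nonneg _ _ _
  · exact T.vertexFun_nonneg _ _ _ _

open Classical in
-- Each block belongs to a single vertex of the face, so at most one extraordinary vertex
-- contributes to a given coefficient.
lemma sum_vertexFun (b : M.ExtraVert → Fin 3 → ℝ) (σ : F) (ξ : UnitSquare) :
    ∑ γ, ∑ ν, b γ ν * T.vertexFun γ ν σ ξ = splineFun (fun j k =>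
      if h : M.IsExtraordinary (M.vert σ (nearestVertex j k)) then
        ∑ ν, b ⟨_, h⟩ ν * barycentric (T.tri ⟨_, h⟩) (G.proj ⟨_, h⟩ (G.refinedCoeff σ j k)) ν
      else 0) ξ := by
  simp only [vertexFun]
  rw [← Fintype.sum_prod_type' fun γ ν => b γ ν * splineFun (fun j k =>
    if M.vert σ (nearestVertex j k) = γ.1 then
      barycentric (T.tri γ) (G.proj γ (G.refinedCoeff σ j k)) ν else 0) ξ,
    splineFun_sum Finset.univ fun x : M.ExtraVert × Fin 3 => b x.1 x.2]
  congr 1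
  funext j k
  rw [Fintype.sum_prod_type]
  split_ifs with h
  · rw [Fintype.sum_eq_single ⟨_, h⟩]
    · simp
    · intro γ hγ
      exact Finset.sum_eq_zero fun ν _ => by
        rw [if_neg fun e => hγ (Subtype.ext e.symm), mul_zero]
  · exact Finset.sum_eq_zero fun γ _ => Finset.sum_eq_zero fun ν _ => by
      rw [if_neg fun e : M.vert σ _ = γ.1 => h (by rw [e]; exact γ.2), mul_zero]

open Classical in
/-- Local representation of a linear combination of the basis functions. -/
lemma sum_mul_basisFun {a : M.Dof → ℝ} {a' : M.StarDof → ℝ}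
    (hF : ∀ σ, a (.inl σ) = a' (.inl σ.1))
    (hE : ∀ τ, a (.inr (.inl τ)) = a' (.inr (.inl ⟨τ.1, τ.2.1⟩)))
    (hC : ∀ γ, a (.inr (.inr (.inl γ))) = a' (.inr (.inr γ))) (σ : F) (ξ : UnitSquare) :
    ∑ φ, a φ * T.basisFun φ σ ξ =
      if M.IsExtraordinaryFace σ then splineFun (fun j k =>
        if h : M.IsExtraordinary (M.vert σ (nearestVertex j k)) then
          ∑ ν, a (.inr (.inr (.inr (⟨_, h⟩, ν)))) *
            barycentric (T.tri ⟨_, h⟩) (G.proj ⟨_, h⟩ (G.refinedCoeff σ j k)) ν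
        else refine (fun p q => ∑ φ, a' φ * M.starCoeff φ (M.domainPoint σ p q)) j k) ξ
      else bezierFun (fun p q => ∑ φ, a' φ * M.starCoeff φ (M.domainPoint σ p q)) ξ := by
  -- Functions of `𝓘*` missing from `𝓘` are annihilated by truncation, so the values of `a'` on them
  -- are free.
  rw [sum_dof_eq_sum_starDof (g := fun φ => a' φ * M.truncatedFun φ σ ξ)
    (fun σ' => by rw [hF]; rfl) (fun τ => by rw [hE]; rfl) (fun γ => by rw [hC]; rfl)
    fun φ hφ => by rw [truncatedFun_eq_zero fun i => hφ _, mul_zero], sum_truncatedFun]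
  have hv := T.sum_vertexFun (fun γ ν => a (.inr (.inr (.inr (γ, ν))))) σ ξ
  simp only [basisFun] at hv ⊢
  rw [hv]
  split_ifs with hσ
  · rw [← splineFun_add]
    congr 1
    funext j k
    split_ifs <;> simp
  · rw [add_eq_left]
    exact splineFun_eq_zero
      (fun j k => dif_neg fun h => hσ (isExtraordinaryFace_of_vert h)) ξ

lemma sum_basisFun (σ : F) (ξ : UnitSquare) : ∑ φ, T.basisFun φ σ ξ = 1 := by
  -- Taking `a' = 1` on the discarded functions as well makes the coefficient at every domain point
  -- the full sum over `𝓘*`, which is one.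
  have h := T.sum_mul_basisFun (a := fun _ => 1) (a' := fun _ => 1) (fun _ => rfl) (fun _ => rfl)
    (fun _ => rfl) σ ξ
  simp only [one_mul, sum_starCoeff] at h
  rw [h]
  split_ifs
  · refine splineFun_eq_one (fun j k => ?_) ξ
    split_ifs with hγ
    · exact (T.barycentric_spec ⟨_, hγ⟩ rfl).2.1
    · exact refine_one j k
  · exact bezierFun_eq_one (fun _ _ => rfl) ξ

open Classical in
/-- If a linear combination of the basis functions vanishes, so do its coefficients at all domain
points near vertices that are not extraordinary. -/
lemma coeff_eq_zero_of_sum_eq_zero {a : M.Dof → ℝ} {a' : M.StarDof → ℝ}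
    (hF : ∀ σ, a (.inl σ) = a' (.inl σ.1))
    (hE : ∀ τ, a (.inr (.inl τ)) = a' (.inr (.inl ⟨τ.1, τ.2.1⟩)))
    (hC : ∀ γ, a (.inr (.inr (.inl γ))) = a' (.inr (.inr γ)))
    (h : ∀ σ ξ, ∑ φ, a φ * T.basisFun φ σ ξ = 0) {σ : F} {i : Fin 4}
    (hi : ¬ M.IsExtraordinary (M.vert σ i)) :
    ∀ D ∈ M.nearPoints σ i, ∑ φ, a' φ * M.starCoeff φ D = 0 := by
  have h' := h σ
  simp only [T.sum_mul_basisFun hF hE hC] at h'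
  split_ifs at h' with hσ
  · refine nearPoints_eq_zero_of_refine fun j k hjk => ?_
    have := splineFun_coeff_eq_zero h' j k
    rwa [dif_neg (hjk ▸ hi)] at this
  · intro D hD
    obtain ⟨p, q, rfl⟩ := exists_domainPoint_eq hD
    exact bezierFun_coeff_eq_zero h' p q

open Classical in
/-- Extension of coefficients by zero from `𝓘` to `𝓘*`. -/
noncomputable def extendCoeff (a : M.Dof → ℝ) : M.StarDof → ℝ
  | .inl σ => if h : ∃ γ, ¬ M.IsExtraordinary γ ∧ M.VertInFace γ σ then a (.inl ⟨σ, h⟩) else 0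
  | .inr (.inl τ) => if h : ∃ γ, ¬ M.IsExtraordinary γ ∧ M.VertInEdge γ τ.1 then
      a (.inr (.inl ⟨τ.1, τ.2, h⟩)) else 0
  | .inr (.inr γ) => a (.inr (.inr (.inl γ)))

lemma linearIndependent_basisFun (hG : G.IsRegular) : LinearIndependent ℝ T.basisFun := by
  classical
  rw [Fintype.linearIndependent_iff]
  intro a ha
  have h0 : ∀ σ ξ, ∑ φ, a φ * T.basisFun φ σ ξ = 0 := fun σ ξ => by
    simpa using congrFun (congrFun ha σ) ξ
  have hF : ∀ σ, a (.inl σ) = extendCoeff a (.inl σ.1) := fun σ => by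
    simp only [extendCoeff, dif_pos σ.2]
  have hE : ∀ τ, a (.inr (.inl τ)) = extendCoeff a (.inr (.inl ⟨τ.1, τ.2.1⟩)) :=
    fun τ => by simp only [extendCoeff, dif_pos τ.2.2]
  have hC : ∀ γ, a (.inr (.inr (.inl γ))) = extendCoeff a (.inr (.inr γ)) := fun γ => rfl
  have key := fun σ i => T.coeff_eq_zero_of_sum_eq_zero hF hE hC h0 (σ := σ) (i := i)
  rintro (⟨σ, γ, hγ, i, rfl⟩ | ⟨τ, hτ, γ, hγ, hγτ⟩ | γ | ⟨γ, ν⟩)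
  -- At the centre of `σ` only the function of `σ` has a nonzero coefficient.
  · have h := key σ i hγ (.inr (.inr σ)) (by simp [nearPoints])
    rw [sum_starDof] at h
    simp only [starCoeff, mul_zero, Finset.sum_const_zero, add_zero, mul_ite, mul_one] at h
    rw [Finset.sum_ite_eq, if_pos (Finset.mem_univ _)] at h
    rw [hF]
    exact h
  · obtain ⟨σ, j, rfl⟩ := M.edge_cover τ
    -- The boundary edge is a near point of its end `γ`, which is not extraordinary, and only its
    -- own function has a nonzero coefficient there.
    have hnear : ∃ i, M.vert σ i = γ ∧ Sum.inr (Sum.inl (M.edge σ j)) ∈ M.nearPoints σ i := by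
      rw [VertInEdge, M.ends_edge, Sym2.mem_iff] at hγτ
      rcases hγτ with rfl | rfl
      · exact ⟨j, rfl, by simp [nearPoints]⟩
      · refine ⟨j + 1, rfl, ?_⟩
        have : j + 1 + 3 = j := by rw [add_assoc]; simp
        simp [nearPoints, this]
    obtain ⟨i, rfl, hi⟩ := hnear
    have h := key σ i hγ _ hi
    rw [sum_starDof] at h
    simp only [starCoeff, hτ, not_true_eq_false, and_false, if_false, mul_zero,
      Finset.sum_const_zero, add_zero, zero_add, mul_ite, mul_one] at h
    rw [Fintype.sum_eq_single ⟨_, hτ⟩ fun τ' hτ' => if_neg fun e => hτ' (Subtype.ext e.symm),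
      if_pos rfl] at h
    rw [hE]
    exact h
  · obtain ⟨σ, i, hi⟩ := M.vert_cover γ.1
    have hb : M.IsBoundaryVertex γ.1 := γ.2.isBoundaryVertex
    -- A corner is a boundary vertex, so face functions vanish there; boundary edge functions
    -- exclude corners by definition. Only the corner function remains.
    have h := key σ i (hi ▸ γ.2.not_isExtraordinary) (.inl γ.1) (by simp [nearPoints, hi])
    rw [sum_starDof] at h
    simp only [starCoeff, hb, γ.2, not_true_eq_false, and_false, if_false, mul_zero,
      Finset.sum_const_zero, zero_add, mul_ite, mul_one] at h
    rw [Fintype.sum_eq_single γ fun γ' hγ' => if_neg fun e => hγ' (Subtype.ext e.symm),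
      if_pos rfl] at h
    rw [hC]
    exact h
  -- The spline coefficients in the blocks at `γ` are the values at the local control points of the
  -- linear form with coefficients `a (γ, ν)`.
  · have h := eq_zero_of_not_collinear (hG γ) (T.tri γ).points (barycentric (T.tri γ))
      (fun c hc => (AlmostC1.barycentric_spec _ (T.covers γ hc)).2.1)
      (fun c hc => (AlmostC1.barycentric_spec _ (T.covers γ hc)).2.2)
      (a := fun ν => a (.inr (.inr (.inr (γ, ν))))) ?_
    · exact congrFun h ν
    · rintro c ⟨σ, j, k, hγ, rfl⟩
      obtain ⟨γ, hex⟩ := γ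
      dsimp only at hγ
      subst hγ
      have h' := h0 σ
      simp only [T.sum_mul_basisFun hF hE hC, isExtraordinaryFace_of_vert hex, if_true] at h'
      have := splineFun_coeff_eq_zero h' j k
      rwa [dif_pos hex] at this

end Geometry.ControlTriangles

end QuadMesh

end AlmostC1

theorem proposition3p8 {V E F : Type*} [Fintype V] [Fintype E] [Fintype F]
    (M : AlmostC1.QuadMesh V E F) {m : ℕ} (G : M.Geometry m) (hG : G.IsRegular)
    (T : G.ControlTriangles) :
    -- number of degrees of freedom
    (Nat.card M.Dof ≤ Nat.card F + Nat.card {τ : E // M.IsBoundaryEdge τ}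
        + Nat.card {γ : V // M.IsCorner γ} + 3 * Nat.card M.ExtraVert) ∧
    ((∀ σ : F, ¬ ∀ γ, M.VertInFace γ σ → M.IsExtraordinary γ) →
      (∀ τ : E, M.IsBoundaryEdge τ → ¬ ∀ γ, M.VertInEdge γ τ → M.IsExtraordinary γ) →
      Nat.card M.Dof = Nat.card F + Nat.card {τ : E // M.IsBoundaryEdge τ}
        + Nat.card {γ : V // M.IsCorner γ} + 3 * Nat.card M.ExtraVert) ∧
    -- non-negativity
    (∀ φ σ ξ, 0 ≤ T.basisFun φ σ ξ) ∧
    -- partition of unity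
    (∀ σ ξ, ∑ φ, T.basisFun φ σ ξ = 1) ∧
    -- local support of face, boundary edge, corner and extraordinary vertex functions
    ((∀ φ σ, (∀ γ, ¬ (M.VertInFace γ φ.1 ∧ M.VertInFace γ σ)) →
        ∀ ξ, T.basisFun (.inl φ) σ ξ = 0) ∧
      (∀ φ σ, (∀ γ, ¬ (M.VertInEdge γ φ.1 ∧ M.VertInFace γ σ)) →
        ∀ ξ, T.basisFun (.inr (.inl φ)) σ ξ = 0) ∧
      (∀ φ σ, ¬ M.VertInFace φ.1 σ → ∀ ξ, T.basisFun (.inr (.inr (.inl φ))) σ ξ = 0) ∧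
      (∀ γ ν σ, ¬ M.VertInFace γ.1 σ →
        ∀ ξ, T.basisFun (.inr (.inr (.inr (γ, ν)))) σ ξ = 0)) ∧
    -- face functions vanish on the boundary, which consists of the boundary edges and vertices
    ((∀ φ σ i, M.IsBoundaryEdge (M.edge σ i) → ∀ ξ, AlmostC1.OnLocalEdge i ξ →
        T.basisFun (.inl φ) σ ξ = 0) ∧
      (∀ φ σ i, M.IsBoundaryVertex (M.vert σ i) →
        T.basisFun (.inl φ) σ (AlmostC1.localVertex i) = 0)) ∧
    -- the functions form a basis of the spline space
    (LinearIndependent ℝ T.basisFun ∧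
      ∃ b : Module.Basis M.Dof ℝ T.splineSpace,
        ∀ φ, (b φ : F → AlmostC1.UnitSquare → ℝ) = T.basisFun φ) := by
  classical
  refine ⟨AlmostC1.QuadMesh.card_dof_le, AlmostC1.QuadMesh.card_dof_eq, T.basisFun_nonneg,
    T.sum_basisFun, ⟨fun φ σ h ξ => ?_, fun φ σ h ξ => ?_, fun φ σ h ξ => ?_,
      fun γ ν σ h ξ => T.vertexFun_eq_zero h ν ξ⟩,
    ⟨fun φ σ i hi ξ hξ => ?_, fun φ σ i hi => ?_⟩, T.linearIndependent_basisFun hG,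
    Module.Basis.span (T.linearIndependent_basisFun hG),
    fun φ => congrArg Subtype.val (Module.Basis.span_apply (T.linearIndependent_basisFun hG) φ)⟩
  -- If `σ` and `φ` are disjoint, the condition that their common vertices be extraordinary holds
  -- vacuously.
  · exact AlmostC1.QuadMesh.truncatedFun_eq_zero (fun i hm => absurd ⟨hm, i, rfl⟩ (h _)) ξ
  · exact AlmostC1.QuadMesh.truncatedFun_eq_zero (fun i hm => absurd ⟨hm, i, rfl⟩ (h _)) ξ
  · exact AlmostC1.QuadMesh.truncatedFun_eq_zero (fun i hm => absurd ⟨i, hm.symm⟩ h) ξ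
  · refine AlmostC1.QuadMesh.truncatedFun_eq_zero_of_edge
      (AlmostC1.QuadMesh.starCoeff_face_boundaryVertex _ ⟨_, hi, ?_⟩)
      (AlmostC1.QuadMesh.starCoeff_face_boundaryVertex _ ⟨_, hi, ?_⟩)
      (AlmostC1.QuadMesh.starCoeff_face_boundaryEdge _ hi) hξ
    · exact (M.vertInEdge_edge σ _ _).2 (Or.inl rfl)
    · exact (M.vertInEdge_edge σ _ _).2 (Or.inr rfl)
  · exact AlmostC1.QuadMesh.truncatedFun_localVertex_eq_zero
      (AlmostC1.QuadMesh.starCoeff_face_boundaryVertex _ hi)
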